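/- For $k_F\ge 1$ let $B_F=\{p\in\mathbb Z^3:|p|\le k_F\}$ (Euclidean norm) and $\mathbb Z^3_*=\mathbb Z^3\setminus\{0\}$. For $k\in\mathbb Z^3_*$ and $p\in\mathbb Z^3$ put $$L_k=\{p\in\mathbb Z^3:|p-k|\le k_F<|p|\},\qquad L_k'=L_k-k,\qquad \lambda_{k,p}=\tfrac12\big(|p|^2-|p-k|^2\big),$$ $$\kappa=\tfrac12\Big(\inf_{p\in\mathbb Z^3\setminus B_F}|p|^2+\sup_{q\in B_F}|q|^2\Big),\qquad m(p)=\big||p|^2-\kappa\big|^{-1},$$ and let $\chi_A$ denote the characteristic function of a set $A$. (Terms in which the characteristic function vanishes are read as $0$.) Lemma 2.9. For every $\delta>0$ there is a constant $C_\delta>0$, depending only on $\delta$ (in particular independent of $\xi$ and $k_F$), such that for all $k_F\ge 1$ and all $\xi\in\mathbb Z^3$ both of the following series converge and $$\sum_{k\in\mathbb Z^3_*}\frac{\chi_{L_k}(\xi)}{\lambda_{k,\xi}}\le C_\delta\,k_F^{1+\delta},\qquad \sum_{k\in\mathbb Z^3_*}\frac{\chi_{L_k'}(\xi)}{\lambda_{k,k+\xi}^2}\le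 C_\delta\,k_F^{1+\delta}\,m(\xi).$$ -/

import Mathlib

namespace FermiGas

/-- The momentum lattice `ℤ³`. -/
abbrev Lattice : Type := Fin 3 → ℤ

/-- The punctured lattice `ℤ³ \ {0}`. -/
abbrev LatticeStar : Type := {k : Lattice // k ≠ 0}

/-- The Euclidean length `|p|` of a lattice point. -/
noncomputable def eNorm (p : Lattice) : ℝ := Real.sqrt (∑ i, (p i : ℝ) ^ 2)

/-- The Fermi ball `B_F = {p ∈ ℤ³ : |p| ≤ k_F}`. -/
def fermiBall (kF : ℝ) : Set Lattice := {p | eNorm p ≤ kF}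

/-- The lune `L_k = {p ∈ ℤ³ : |p - k| ≤ k_F < |p|}`. -/
def lune (kF : ℝ) (k : Lattice) : Set Lattice := {p | eNorm (p - k) ≤ kF ∧ kF < eNorm p}

/-- The set of hole states `L'_k = L_k - k`. -/
def holeLune (kF : ℝ) (k : Lattice) : Set Lattice := (fun p => p - k) '' lune kF k

/-- `λ_{k,p} = (|p|² - |p - k|²) / 2`. -/
noncomputable def gap (k p : Lattice) : ℝ := (1 / 2) * (eNorm p ^ 2 - eNorm (p - k) ^ 2)

/-- `κ = (inf_{p ∉ B_F} |p|² + sup_{q ∈ B_F} |q|²) / 2`. -/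
noncomputable def kappa (kF : ℝ) : ℝ :=
  (1 / 2) * (sInf ((fun p => eNorm p ^ 2) '' (fermiBall kF)ᶜ)
    + sSup ((fun q => eNorm q ^ 2) '' fermiBall kF))

/-- `m(p) = ||p|² - κ|⁻¹`. -/
noncomputable def m (kF : ℝ) (p : Lattice) : ℝ := |eNorm p ^ 2 - kappa kF|⁻¹

/-- The characteristic function `χ_A`. -/
noncomputable def chi (A : Set Lattice) : Lattice → ℝ := A.indicator 1

end FermiGas

namespace FermiGas

-- For fixed `ξ` the substitutions `p = ξ - k` and `p = k + ξ` turn both series into sums over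
-- distinct lattice points of a function of `|p|²` alone. Grouping by `n = |p|²` leaves one-variable
-- sums weighted by the number of lattice points with `|p|² = n`. This number is `O(n^s)` for every
-- `s > 1/2`: each of the `O(√n)` planar slices is counted by representations as a sum of two
-- squares, hence by Gaussian integers of given norm, of which there are `O(n^ε)`. The first series
-- becomes `∑ (n+1)^s / (|ξ|² - n)` over `n ≤ k_F² < |ξ|²`, a harmonic sum costing only a logarithm.
-- The second becomes `∑ (n+1)^s / (n - |ξ|²)²` over `n ≥ N`, with `N` the least squared length
-- outside the ball; it is `O(N^s / (N - |ξ|²))`, and `|ξ|² < κ ≤ N` turns the denominator into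
-- `m(ξ)`. Since `N ≤ 4 k_F²`, the power `N^s` gives `k_F^{2s}`.

local notation "ℤ[i]" => GaussianInt

/-! ### Counting Gaussian integers of given norm. -/

theorem mem_of_gaussian_norm_eq_one {w : ℤ[i]} (h : w.norm = 1) :
    w ∈ ({1, -1, ⟨0, 1⟩, ⟨0, -1⟩} : Finset ℤ[i]) := by
  obtain ⟨x, y⟩ := w
  rw [Zsqrtd.norm_def] at h
  simp only at h
  have hx : x ^ 2 ≤ 1 := by nlinarith [sq_nonneg y]
  have hy : y ^ 2 ≤ 1 := by nlinarith [sq_nonneg x]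
  have hx1 : x ≤ 1 := by nlinarith
  have hx2 : -1 ≤ x := by nlinarith
  have hy1 : y ≤ 1 := by nlinarith
  have hy2 : -1 ≤ y := by nlinarith
  interval_cases x <;> interval_cases y <;> simp_all [Zsqrtd.ext_iff]

/-- A Gaussian integer dividing a positive integer `m` has a norm dividing `m ^ 2`. -/
theorem norm_dvd_sq_of_dvd_intCast {u : ℤ[i]} {m : ℤ} (h : u ∣ (m : ℤ[i])) :
    u.norm ∣ m ^ 2 := by
  obtain ⟨v, hv⟩ := h
  refine ⟨v.norm, ?_⟩
  rw [← Zsqrtd.norm_mul, ← hv, Zsqrtd.norm_intCast, sq]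

theorem dvd_norm (w : ℤ[i]) : w ∣ (w.norm : ℤ[i]) := by
  rw [Zsqrtd.norm_eq_mul_conj]; exact Dvd.intro _ rfl

/-- A Gaussian integer whose norm is a product of coprime factors splits accordingly. -/
theorem exists_mul_of_norm_eq_mul {m n : ℕ} (hm : m ≠ 0) (hn : n ≠ 0) (hmn : m.Coprime n)
    {w : ℤ[i]} (hw : w.norm = m * n) :
    ∃ u v : ℤ[i], u.norm = m ∧ v.norm = n ∧ u * v = w := by
  have hd : w ∣ ((m : ℤ) : ℤ[i]) * ((n : ℤ) : ℤ[i]) := by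
    rw [← Int.cast_mul, ← hw]; exact dvd_norm w
  obtain ⟨u, v, hu, hv, rfl⟩ := exists_dvd_and_dvd_of_dvd_mul hd
  have hun := norm_dvd_sq_of_dvd_intCast hu
  have hvn := norm_dvd_sq_of_dvd_intCast hv
  rw [Zsqrtd.norm_mul] at hw
  have hc : IsCoprime (m : ℤ) (n : ℤ) := hmn.isCoprime
  have h1 : u.norm ∣ m :=
    ((hc.pow_left (m := 2)).of_isCoprime_of_dvd_left hun).dvd_of_dvd_mul_right (Dvd.intro _ hw)
  have h2 : v.norm ∣ n :=
    ((hc.symm.pow_left (m := 2)).of_isCoprime_of_dvd_left hvn).dvd_of_dvd_mul_left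
      (Dvd.intro_left _ hw)
  have hm0 : (0 : ℤ) < m := by exact_mod_cast Nat.pos_of_ne_zero hm
  have hn0 : (0 : ℤ) < n := by exact_mod_cast Nat.pos_of_ne_zero hn
  have l1 := Int.le_of_dvd hm0 h1
  have l2 := Int.le_of_dvd hn0 h2
  have p1 := GaussianInt.norm_nonneg u
  have p2 := GaussianInt.norm_nonneg v
  -- The norms are at most `m` and `n` while their product is `m * n`, so both are equalities.
  refine ⟨u, v, ?_, ?_, rfl⟩ <;> nlinarith

/-- The Gaussian integers of norm `p ^ a` lie in a set of at most `4 (a + 1) ^ 2` elements. -/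
theorem exists_cover_norm_prime_pow {p : ℕ} (hp : p.Prime) (a : ℕ) :
    ∃ T : Finset ℤ[i], T.card ≤ 4 * (a + 1) ^ 2 ∧ ∀ w : ℤ[i], w.norm = (p : ℤ) ^ a → w ∈ T := by
  have hpn : ¬ IsUnit ((p : ℤ) : ℤ[i]) := by
    rw [← Zsqrtd.norm_eq_one_iff, Zsqrtd.norm_intCast, Int.natAbs_mul]
    simp [hp.one_lt.ne']
  have hp0 : ((p : ℤ) : ℤ[i]) ≠ 0 := by exact_mod_cast hp.ne_zero
  obtain ⟨π, hπ, hπp⟩ := WfDvdMonoid.exists_irreducible_factor hpn hp0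
  have hπ' : Prime π := hπ.prime
  have hπs : Prime (star π) := (MulEquiv.prime_iff (starMulAut : ℤ[i] ≃* ℤ[i])).2 hπ'
  -- The norm of `π` divides `p ^ 2` and is not `1`, so `p` divides it. Hence every irreducible
  -- factor of `p` is associated to `π` or `star π`.
  have hdvd : ((p : ℤ) : ℤ[i]) ∣ π * star π := by
    rw [← Zsqrtd.norm_eq_mul_conj]
    refine Int.cast_dvd_cast _ _ ?_
    have h2 := norm_dvd_sq_of_dvd_intCast hπp
    have h3 : π.norm.natAbs ∣ p ^ 2 := by
      have := Int.natAbs_dvd_natAbs.2 h2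
      rwa [Int.natAbs_pow, Int.natAbs_natCast] at this
    obtain ⟨k, hk, hka⟩ := (Nat.dvd_prime_pow hp).1 h3
    have hk0 : k ≠ 0 := by
      rintro rfl
      exact hπ.not_isUnit (Zsqrtd.norm_eq_one_iff.1 (by simpa using hka))
    rw [← Int.natAbs_dvd_natAbs, hka, Int.natAbs_natCast]
    exact dvd_pow_self _ hk0
  -- Strong induction is needed: removing one factor lowers the exponent by `2` when `p` is inert.
  have key : ∀ b : ℕ, ∀ w : ℤ[i], w.norm = (p : ℤ) ^ b →
      ∃ u : ℤ[i], ∃ i j : ℕ, u.norm = 1 ∧ i ≤ b ∧ j ≤ b ∧ w = u * (π ^ i * star π ^ j) := by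
    intro b
    induction b using Nat.strong_induction_on with
    | _ b ih =>
      intro w hw
      rcases Nat.eq_zero_or_pos b with rfl | hb
      · exact ⟨w, 0, 0, by simpa using hw, le_rfl, le_rfl, by simp⟩
      have hwn : ¬ IsUnit w := by
        rw [← Zsqrtd.norm_eq_one_iff, hw, Int.natAbs_pow, Int.natAbs_natCast]
        exact (Nat.one_lt_pow hb.ne' hp.one_lt).ne'
      have hw0 : w ≠ 0 := by
        rw [← GaussianInt.norm_pos, hw]
        have := hp.pos
        positivity
      obtain ⟨ρ, hρ, hρw⟩ := WfDvdMonoid.exists_irreducible_factor hwn hw0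
      have hρp : ρ ∣ ((p : ℤ) : ℤ[i]) := by
        have h := hρw.trans (dvd_norm w)
        rw [hw, Int.cast_pow] at h
        exact hρ.prime.dvd_of_dvd_pow h
      have step : ∀ σ : ℤ[i], σ ∣ w → ¬ IsUnit σ →
          ∃ c < b, ∃ v : ℤ[i], v.norm = (p : ℤ) ^ c ∧ w = σ * v := by
        rintro σ ⟨v, rfl⟩ hσ
        rw [Zsqrtd.norm_mul] at hw
        have hv : v.norm.natAbs ∣ p ^ b := by
          have := Int.natAbs_dvd_natAbs.2 (Dvd.intro_left _ hw)
          rwa [Int.natAbs_pow, Int.natAbs_natCast] at this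
        obtain ⟨c, hc, hvc⟩ := (Nat.dvd_prime_pow hp).1 hv
        have hvn : v.norm = (p : ℤ) ^ c := by
          rw [← GaussianInt.abs_natCast_norm, hvc]; push_cast; rfl
        refine ⟨c, lt_of_le_of_ne hc ?_, v, hvn, rfl⟩
        rintro rfl
        refine hσ (Zsqrtd.norm_eq_one_iff.1 ?_)
        rw [hvn] at hw
        have hpc : (p : ℤ) ^ c ≠ 0 := pow_ne_zero _ (by exact_mod_cast hp.ne_zero)
        have := mul_right_cancel₀ hpc (hw.trans (one_mul _).symm)
        rw [this]; rfl
      rcases hρ.prime.dvd_or_dvd (hρp.trans hdvd) with h | h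
      · have ha := (hρ.prime.irreducible.associated_of_dvd hπ h)
        obtain ⟨c, hc, v, hv, rfl⟩ := step π (ha.symm.dvd.trans hρw) hπ.not_isUnit
        obtain ⟨u, i, j, hu, hi, hj, rfl⟩ := ih c hc v hv
        exact ⟨u, i + 1, j, hu, by omega, by omega, by ring⟩
      · have ha := (hρ.prime.irreducible.associated_of_dvd hπs.irreducible h)
        obtain ⟨c, hc, v, hv, rfl⟩ := step (star π) (ha.symm.dvd.trans hρw) hπs.not_isUnit
        obtain ⟨u, i, j, hu, hi, hj, rfl⟩ := ih c hc v hv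
        exact ⟨u, i, j + 1, hu, by omega, by omega, by ring⟩
  refine ⟨(({1, -1, ⟨0, 1⟩, ⟨0, -1⟩} : Finset ℤ[i]) ×ˢ
    (Finset.range (a + 1) ×ˢ Finset.range (a + 1))).image
      (fun x => x.1 * (π ^ x.2.1 * star π ^ x.2.2)), ?_, ?_⟩
  · refine Finset.card_image_le.trans ?_
    rw [Finset.card_product, Finset.card_product, Finset.card_range, ← sq]
    exact Nat.mul_le_mul_right _ Finset.card_le_four
  · intro w hw
    obtain ⟨u, i, j, hu, hi, hj, rfl⟩ := key a w hw
    refine Finset.mem_image.2 ⟨(u, i, j), ?_, rfl⟩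
    simp only [Finset.mem_product, Finset.mem_range]
    exact ⟨mem_of_gaussian_norm_eq_one hu, by omega, by omega⟩

/-- Polynomial growth in the exponent is dominated by small powers, uniformly in the base. -/
theorem exists_prime_pow_bound {ε : ℝ} (hε : 0 < ε) :
    ∃ A : ℝ, 1 ≤ A ∧ ∃ P : ℕ, ∀ p a : ℕ, 2 ≤ p → 1 ≤ a →
      (4 * (a + 1) ^ 2 : ℝ) ≤ (if p < P then A else 1) * ((p ^ a : ℕ) : ℝ) ^ ε := by
  set t : ℝ := ε * Real.log 2 / 2 with ht
  have hl : 0 < Real.log 2 := Real.log_pos one_lt_two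
  have ht0 : 0 < t := by positivity
  -- Small primes use `a + 1 ≤ (1 + 1/t)(1 + a t)` and `1 + a t ≤ exp (a t)`. Beyond the threshold
  -- `p ^ ε ≥ 16`, and `4 (a + 1) ^ 2 ≤ 16 ^ a` needs no constant.
  refine ⟨4 * (1 + 1 / t) ^ 2, ?_, ⌈(16 : ℝ) ^ (1 / ε)⌉₊, ?_⟩
  · have : 0 < 1 / t := by positivity
    nlinarith
  intro p a hp ha
  have hp0 : (0 : ℝ) ≤ p := p.cast_nonneg
  have hpow : ((p ^ a : ℕ) : ℝ) ^ ε = ((p : ℝ) ^ ε) ^ a := by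
    push_cast
    rw [← Real.rpow_natCast, ← Real.rpow_natCast, ← Real.rpow_mul hp0, ← Real.rpow_mul hp0,
      mul_comm]
  rw [hpow]
  split_ifs with h
  · have h2 : Real.exp (2 * t) ≤ (p : ℝ) ^ ε := by
      have : Real.exp (2 * t) = (2 : ℝ) ^ ε := by
        rw [Real.rpow_def_of_pos two_pos, ht]; congr 1; ring
      rw [this]
      exact Real.rpow_le_rpow zero_le_two (by exact_mod_cast hp) hε.le
    have h3 : (1 + a * t) ^ 2 ≤ ((p : ℝ) ^ ε) ^ a := by
      calc (1 + a * t) ^ 2 ≤ (Real.exp (a * t)) ^ 2 := by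
            gcongr; linarith [Real.add_one_le_exp (a * t)]
        _ = Real.exp (2 * t) ^ a := by
            rw [← Real.exp_nat_mul, ← Real.exp_nat_mul]; congr 1; push_cast; ring
        _ ≤ _ := by gcongr
    have h4 : (a + 1 : ℝ) ≤ (1 + 1 / t) * (1 + a * t) := by
      have : (1 + 1 / t) * (1 + a * t) = 1 + a + (a * t + 1 / t) := by field_simp; ring
      rw [this]
      have : 0 ≤ a * t + 1 / t := by positivity
      linarith
    calc (4 * (a + 1) ^ 2 : ℝ) ≤ 4 * ((1 + 1 / t) * (1 + a * t)) ^ 2 := by gcongr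
      _ = 4 * (1 + 1 / t) ^ 2 * (1 + a * t) ^ 2 := by ring
      _ ≤ _ := by gcongr
  · have h16 : (16 : ℝ) ≤ (p : ℝ) ^ ε := by
      have h1 : (16 : ℝ) ^ (1 / ε) ≤ p := (Nat.le_ceil _).trans (by exact_mod_cast not_lt.1 h)
      calc (16 : ℝ) = ((16 : ℝ) ^ (1 / ε)) ^ ε := by
            rw [← Real.rpow_mul (by norm_num), one_div_mul_cancel hε.ne', Real.rpow_one]
        _ ≤ _ := by gcongr
    have h5 : (4 * (a + 1) ^ 2 : ℝ) ≤ 16 ^ a := by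
      clear hpow
      induction a, ha using Nat.le_induction with
      | base => norm_num
      | succ n hn ih =>
        rw [pow_succ (16 : ℝ) n]
        push_cast
        nlinarith [ih, n.cast_nonneg (α := ℝ)]
    rw [one_mul]
    exact h5.trans (by gcongr)

/-- The number of representations of `n` as a sum of two squares is `O(n ^ ε)`. -/
theorem exists_cover_norm {ε : ℝ} (hε : 0 < ε) :
    ∃ C : ℝ, 1 ≤ C ∧ ∀ n : ℕ, ∃ T : Finset ℤ[i], (T.card : ℝ) ≤ C * ((n : ℝ) + 1) ^ ε ∧
      ∀ w : ℤ[i], w.norm = n → w ∈ T := by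
  obtain ⟨A, hA, P, hAP⟩ := exists_prime_pow_bound hε
  have hA0 : 0 ≤ A := zero_le_one.trans hA
  -- The bound is multiplicative over coprime factors. Only primes below `P` contribute a factor
  -- `A`, so the product stays below `A ^ P` whatever `n` is.
  have key : ∀ n : ℕ, 1 < n → ∃ T : Finset ℤ[i],
      (T.card : ℝ) ≤ (∏ p ∈ n.primeFactors, if p < P then A else 1) * (n : ℝ) ^ ε ∧
      ∀ w : ℤ[i], w.norm = n → w ∈ T := by
    intro n
    induction n using Nat.recOnPosPrimePosCoprime with
    | zero => intro h; omega
    | one => intro h; omega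
    | prime_pow p a hp ha =>
      intro _
      obtain ⟨T, hT, hTw⟩ := exists_cover_norm_prime_pow hp a
      refine ⟨T, ?_, fun w hw => hTw w (by simpa using hw)⟩
      rw [Nat.primeFactors_prime_pow ha.ne' hp, Finset.prod_singleton]
      refine le_trans ?_ (hAP p a hp.two_le ha)
      exact_mod_cast hT
    | coprime m n hm hn hmn ihm ihn =>
      intro _
      obtain ⟨T, hT, hTw⟩ := ihm hm
      obtain ⟨U, hU, hUw⟩ := ihn hn
      refine ⟨Finset.image₂ (· * ·) T U, ?_, ?_⟩
      · rw [hmn.primeFactors_mul, Finset.prod_union hmn.disjoint_primeFactors, Nat.cast_mul,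
          Real.mul_rpow m.cast_nonneg n.cast_nonneg]
        calc ((Finset.image₂ (· * ·) T U).card : ℝ) ≤ T.card * U.card := by
              exact_mod_cast Finset.card_image₂_le _ _ _
          _ ≤ _ := mul_le_mul hT hU (Nat.cast_nonneg _) ((Nat.cast_nonneg _).trans hT)
          _ = _ := by ring
      · intro w hw
        obtain ⟨u, v, hu, hv, rfl⟩ := exists_mul_of_norm_eq_mul (by omega) (by omega) hmn
          (by simpa using hw)
        exact Finset.mem_image₂.2 ⟨u, hTw u hu, v, hUw v hv, rfl⟩
  have hAP1 : 1 ≤ A ^ P := one_le_pow₀ hA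
  refine ⟨4 * A ^ P, by linarith, fun n => ?_⟩
  have hn1 : 1 ≤ ((n : ℝ) + 1) ^ ε :=
    Real.one_le_rpow (by linarith [n.cast_nonneg (α := ℝ)]) hε.le
  have hC : 4 ≤ 4 * A ^ P * ((n : ℝ) + 1) ^ ε := by nlinarith
  rcases lt_trichotomy n 1 with h | rfl | h
  · obtain rfl : n = 0 := by omega
    refine ⟨{0}, ?_, fun w hw => ?_⟩
    · rw [Finset.card_singleton, Nat.cast_one]; linarith
    · exact Finset.mem_singleton.2 (GaussianInt.norm_eq_zero.1 (by simpa using hw))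
  · exact ⟨_, le_trans (by exact_mod_cast Finset.card_le_four) hC,
      fun w hw => mem_of_gaussian_norm_eq_one (by simpa using hw)⟩
  · obtain ⟨T, hT, hTw⟩ := key n h
    refine ⟨T, hT.trans ?_, hTw⟩
    have hprod : (∏ p ∈ n.primeFactors, if p < P then A else 1) ≤ A ^ P := by
      rw [Finset.prod_ite, Finset.prod_const, Finset.prod_const_one, mul_one]
      refine pow_le_pow_right₀ hA ?_
      calc _ ≤ (Finset.range P).card := Finset.card_le_card fun p hp => by
            simpa using (Finset.mem_filter.1 hp).2
        _ = P := Finset.card_range P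
    have hpw : (n : ℝ) ^ ε ≤ ((n : ℝ) + 1) ^ ε :=
      Real.rpow_le_rpow n.cast_nonneg (by linarith) hε.le
    calc _ ≤ A ^ P * ((n : ℝ) + 1) ^ ε :=
          mul_le_mul hprod hpw (by positivity) (by linarith)
      _ ≤ _ := by nlinarith

/-! ### Lattice points on spheres. -/

/-- The squared length of a lattice point, as a natural number. -/
def sqNorm (p : Lattice) : ℕ := ∑ i, (p i).natAbs ^ 2

theorem eNorm_sq (p : Lattice) : eNorm p ^ 2 = sqNorm p := by
  rw [eNorm, Real.sq_sqrt (Finset.sum_nonneg fun i _ => sq_nonneg _), sqNorm]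
  push_cast
  refine Finset.sum_congr rfl fun i _ => ?_
  rw [Nat.cast_natAbs, Int.cast_abs, sq_abs]

theorem eNorm_nonneg (p : Lattice) : 0 ≤ eNorm p := Real.sqrt_nonneg _

theorem eNorm_le_iff {kF : ℝ} (hk : 0 ≤ kF) (p : Lattice) :
    eNorm p ≤ kF ↔ (sqNorm p : ℝ) ≤ kF ^ 2 := by
  rw [← eNorm_sq, sq_le_sq₀ (eNorm_nonneg p) hk]

theorem lt_eNorm_iff {kF : ℝ} (hk : 0 ≤ kF) (p : Lattice) :
    kF < eNorm p ↔ kF ^ 2 < (sqNorm p : ℝ) := by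
  rw [← not_le, eNorm_le_iff hk, not_le]

/-- The number of lattice points of squared length `n` is `O(n ^ s)` for every `s > 1 / 2`. -/
theorem exists_card_sphere_le {s : ℝ} (hs : 1 / 2 < s) :
    ∃ C : ℝ, 0 < C ∧ ∀ (n : ℕ) (S : Finset Lattice), (∀ p ∈ S, sqNorm p = n) →
      (S.card : ℝ) ≤ C * ((n : ℝ) + 1) ^ s := by
  obtain ⟨C, hC, hcov⟩ := exists_cover_norm (sub_pos.2 hs)
  refine ⟨3 * C, by linarith, fun n S hS => ?_⟩
  have hsum : ∀ p ∈ S, (p 0).natAbs ^ 2 + (p 1).natAbs ^ 2 + (p 2).natAbs ^ 2 = n := by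
    intro p hp
    rw [← hS p hp, sqNorm, Fin.sum_univ_three]
  have hn0 : (0 : ℝ) ≤ n := n.cast_nonneg
  have hB : 0 ≤ C * ((n : ℝ) + 1) ^ (s - 1 / 2) := by positivity
  have hfib : ∀ z ∈ S.image (fun p => p 0),
      (S.filter fun p => p 0 = z).card ≤ ⌊C * ((n : ℝ) + 1) ^ (s - 1 / 2)⌋₊ := by
    intro z hz
    -- Truncated subtraction is harmless: any point of the slice forces `z ^ 2 ≤ n`.
    obtain ⟨T, hT, hTw⟩ := hcov (n - z.natAbs ^ 2)
    refine Nat.le_floor ?_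
    have hTn : (T.card : ℝ) ≤ C * ((n : ℝ) + 1) ^ (s - 1 / 2) := by
      refine hT.trans ?_
      have : ((n - z.natAbs ^ 2 : ℕ) : ℝ) ≤ n := by exact_mod_cast Nat.sub_le _ _
      gcongr
    refine le_trans ?_ hTn
    have : (S.filter fun p => p 0 = z).card ≤ T.card := by
      refine Finset.card_le_card_of_injOn (fun p => (⟨p 1, p 2⟩ : GaussianInt)) ?_ ?_
      · intro p hp
        obtain ⟨hpS, hpz⟩ := Finset.mem_filter.1 hp
        refine hTw _ ?_
        have h := hsum p hpS
        rw [hpz] at h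
        have h' : n - z.natAbs ^ 2 = (p 1).natAbs ^ 2 + (p 2).natAbs ^ 2 := by omega
        rw [h', Zsqrtd.norm_def]
        push_cast
        rw [sq_abs, sq_abs]
        ring
      · intro p hp q hq hpq
        obtain ⟨-, hpz⟩ := Finset.mem_filter.1 hp
        obtain ⟨-, hqz⟩ := Finset.mem_filter.1 hq
        rw [Zsqrtd.ext_iff] at hpq
        ext i
        fin_cases i
        · exact hpz.trans hqz.symm
        · exact hpq.1
        · exact hpq.2
    exact_mod_cast this
  have himg : (S.image fun p => p 0).card ≤ 2 * n.sqrt + 1 := by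
    calc _ ≤ (Finset.Icc (-(n.sqrt : ℤ)) n.sqrt).card := by
          refine Finset.card_le_card fun z hz => ?_
          obtain ⟨p, hp, rfl⟩ := Finset.mem_image.1 hz
          have : (p 0).natAbs ≤ n.sqrt := Nat.le_sqrt'.2 (by have := hsum p hp; omega)
          rw [Finset.mem_Icc]
          omega
      _ = _ := by rw [Int.card_Icc]; omega
  have hcard := Finset.card_le_mul_card_image S _ hfib
  have hsq : ((2 * n.sqrt + 1 : ℕ) : ℝ) ≤ 3 * ((n : ℝ) + 1) ^ (1 / 2 : ℝ) := by
    rw [← Real.sqrt_eq_rpow]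
    have h1 : (n.sqrt : ℝ) ≤ √((n : ℝ) + 1) :=
      Real.nat_sqrt_le_real_sqrt.trans (Real.sqrt_le_sqrt (by linarith))
    have h2 : 1 ≤ √((n : ℝ) + 1) := Real.one_le_sqrt.2 (by linarith)
    push_cast
    linarith
  calc (S.card : ℝ) ≤ (⌊C * ((n : ℝ) + 1) ^ (s - 1 / 2)⌋₊ : ℝ) * ((2 * n.sqrt + 1 : ℕ) : ℝ) := by
        exact_mod_cast hcard.trans (Nat.mul_le_mul_left _ himg)
    _ ≤ (C * ((n : ℝ) + 1) ^ (s - 1 / 2)) * (3 * ((n : ℝ) + 1) ^ (1 / 2 : ℝ)) :=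
        mul_le_mul (Nat.floor_le hB) hsq (Nat.cast_nonneg _) hB
    _ = 3 * C * (((n : ℝ) + 1) ^ (s - 1 / 2) * ((n : ℝ) + 1) ^ (1 / 2 : ℝ)) := by ring
    _ = _ := by rw [← Real.rpow_add (by linarith)]; congr 2; ring

/-! ### Reduction to one-variable sums and their estimates. -/

/-- A radial sum over distinct lattice points is controlled by a sum over squared lengths. -/
theorem sum_radial_le {C s : ℝ}
    (hC : ∀ (n : ℕ) (S : Finset Lattice), (∀ p ∈ S, sqNorm p = n) →
      (S.card : ℝ) ≤ C * ((n : ℝ) + 1) ^ s)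
    {ι : Type*} {e : ι → Lattice} (he : Function.Injective e) {g : ℕ → ℝ} (hg : ∀ n, 0 ≤ g n)
    {B : ℝ} (hB : ∀ I : Finset ℕ, ∑ n ∈ I, ((n : ℝ) + 1) ^ s * g n ≤ B) (hC0 : 0 ≤ C)
    {f : ι → ℝ} (hf0 : ∀ k, 0 ≤ f k) (hf : ∀ k, f k ≤ g (sqNorm (e k))) :
    Summable f ∧ ∑' k, f k ≤ C * B := by
  have h : ∀ S : Finset ι, ∑ k ∈ S, f k ≤ C * B := by
    intro S
    classical
    calc ∑ k ∈ S, f k ≤ ∑ k ∈ S, g (sqNorm (e k)) := Finset.sum_le_sum fun k _ => hf k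
      _ = ∑ p ∈ S.image e, g (sqNorm p) := 
          (Finset.sum_image (f := fun p => g (sqNorm p)) he.injOn).symm
      _ = ∑ n ∈ (S.image e).image sqNorm,
            ∑ p ∈ (S.image e) with sqNorm p = n, g (sqNorm p) :=
          (Finset.sum_fiberwise_of_maps_to (fun p hp => Finset.mem_image_of_mem _ hp) _).symm
      _ ≤ ∑ n ∈ (S.image e).image sqNorm, C * (((n : ℝ) + 1) ^ s * g n) := by
          refine Finset.sum_le_sum fun n _ => ?_
          rw [Finset.sum_congr rfl fun p hp => by rw [(Finset.mem_filter.1 hp).2],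
            Finset.sum_const, nsmul_eq_mul, ← mul_assoc]
          exact mul_le_mul_of_nonneg_right
            (hC n _ fun p hp => (Finset.mem_filter.1 hp).2) (hg n)
      _ ≤ C * B := by
          rw [← Finset.mul_sum]
          exact mul_le_mul_of_nonneg_left (hB _) hC0
  exact ⟨summable_of_sum_le hf0 h, Real.tsum_le_of_sum_le hf0 h⟩

/-- The sum over squared lengths inside the Fermi ball. -/
theorem sum_interior_le {s : ℝ} (hs : 0 ≤ s) {N M : ℕ} (hNM : N < M) (I : Finset ℕ) :
    ∑ n ∈ I, ((n : ℝ) + 1) ^ s * (if n ≤ N then 2 / ((M : ℝ) - n) else 0) ≤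
      2 * ((N : ℝ) + 1) ^ s * (1 + Real.log ((N : ℝ) + 1)) := by
  have hpos : ∀ n ∈ Finset.range (N + 1), 0 < (N : ℝ) + 1 - n := by
    intro n hn
    have : (n : ℝ) < N + 1 := by exact_mod_cast Finset.mem_range.1 hn
    linarith
  -- Integrality gives `M ≥ N + 1`, which makes the bound independent of `M`; read backwards, the
  -- sum is harmonic.
  calc _ ≤ ∑ n ∈ Finset.range (N + 1), ((N : ℝ) + 1) ^ s * (2 / ((N : ℝ) + 1 - n)) := by
        simp_rw [mul_ite, mul_zero]
        rw [← Finset.sum_filter]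
        refine (Finset.sum_le_sum fun n hn => ?_).trans
          (Finset.sum_le_sum_of_subset_of_nonneg (t := Finset.range (N + 1)) ?_ ?_)
        · have hn' := (Finset.mem_filter.1 hn).2
          have h1 : (n : ℝ) ≤ N := by exact_mod_cast hn'
          have h2 : (N : ℝ) + 1 ≤ M := by exact_mod_cast hNM
          have h3 : (0 : ℝ) < (N : ℝ) + 1 - n := by linarith
          exact mul_le_mul (by gcongr) (by gcongr)
            (div_nonneg zero_le_two (by linarith)) (by positivity)
        · intro n hn
          have hn' := (Finset.mem_filter.1 hn).2
          exact Finset.mem_range.2 (by omega)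
        · intro n hn _
          have := hpos n hn
          positivity
    _ = 2 * ((N : ℝ) + 1) ^ s * ((harmonic (N + 1) : ℚ) : ℝ) := by
        rw [harmonic, ← Finset.sum_range_reflect, Rat.cast_sum, Finset.mul_sum]
        refine Finset.sum_congr rfl fun n hn => ?_
        have hn' : n ≤ N := by have := Finset.mem_range.1 hn; omega
        have h : ((N + 1 - 1 - n : ℕ) : ℝ) = N - n := by
          rw [Nat.add_sub_cancel, Nat.cast_sub hn']
        rw [Rat.cast_inv, Nat.cast_add_one, Rat.cast_add, Rat.cast_natCast, Rat.cast_one, h]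
        have h' : (N : ℝ) + 1 - (N - n) = n + 1 := by ring
        rw [h']
        ring
    _ ≤ _ := by
        gcongr
        exact_mod_cast harmonic_le_one_add_log (N + 1)

/-- Bernoulli's inequality with exponent `1/4` gives `(j / (j+1))^(1/4) ≤ 1 - 1/(4(j+1))`; the
resulting differences telescope in the tail estimate. -/
theorem rpow_neg_telescope {j : ℝ} (hj : 1 ≤ j) :
    (j + 1) ^ (-(5 / 4) : ℝ) ≤ 4 * (j ^ (-(1 / 4) : ℝ) - (j + 1) ^ (-(1 / 4) : ℝ)) := by
  have hj0 : 0 < j := by linarith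
  have hj1 : 0 < j + 1 := by linarith
  set x := j ^ (1 / 4 : ℝ)
  set y := (j + 1) ^ (1 / 4 : ℝ) with hy
  have hx0 : 0 < x := Real.rpow_pos_of_pos hj0 _
  have hy0 : 0 < y := Real.rpow_pos_of_pos hj1 _
  have hber := rpow_one_add_le_one_add_mul_self (s := -(1 / (j + 1))) (p := 1 / 4)
    (by rw [neg_le_neg_iff, div_le_one hj1]; linarith) (by norm_num) (by norm_num)
  have h1 : 1 + -(1 / (j + 1)) = j / (j + 1) := by field_simp; ring
  rw [h1, Real.div_rpow hj0.le hj1.le] at hber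
  have h2 : (j + 1) ^ (-(5 / 4) : ℝ) = 1 / ((j + 1) * y) := by
    rw [Real.rpow_neg hj1.le, one_div, hy]
    congr 1
    nth_rw 2 [← Real.rpow_one (j + 1)]
    rw [← Real.rpow_add hj1]; norm_num
  rw [h2, Real.rpow_neg hj0.le, Real.rpow_neg hj1.le]
  change 1 / ((j + 1) * y) ≤ 4 * (x⁻¹ - y⁻¹)
  have h3 : x * (4 * (j + 1)) ≤ y * (4 * (j + 1) - 1) := by
    have : x / y * (4 * (j + 1)) ≤ 4 * (j + 1) - 1 := by
      calc x / y * (4 * (j + 1)) ≤ (1 + 1 / 4 * -(1 / (j + 1))) * (4 * (j + 1)) := by gcongr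
        _ = _ := by field_simp; ring
    calc x * (4 * (j + 1)) = y * (x / y * (4 * (j + 1))) := by field_simp
      _ ≤ _ := by gcongr
  have hxy : x ≤ y := Real.rpow_le_rpow hj0.le (by linarith) (by norm_num)
  have h4 : 4 * (x⁻¹ - y⁻¹) = 4 * (y - x) / (x * y) := by field_simp
  rw [h4, div_le_div_iff₀ (by positivity) (by positivity)]
  have : x ≤ 4 * (y - x) * (j + 1) := by nlinarith
  nlinarith [mul_le_mul_of_nonneg_right this hy0.le]

/-- The tail of the series `∑ j ^ (-5 / 4)`. -/
theorem sum_tail_rpow_le {d : ℕ} (hd : 1 ≤ d) (J : Finset ℕ) :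
    ∑ j ∈ J with d ≤ j, (j : ℝ) ^ (-(5 / 4) : ℝ) ≤ 5 * (d : ℝ) ^ (-(1 / 4) : ℝ) := by
  have hd1 : (1 : ℝ) ≤ d := by exact_mod_cast hd
  -- Of the constant `5`, the telescoping accounts for `4` and the first term for `1`.
  have hind : ∀ m : ℕ, ∑ j ∈ Finset.Ico d (d + m + 1), (j : ℝ) ^ (-(5 / 4) : ℝ) ≤
      5 * (d : ℝ) ^ (-(1 / 4) : ℝ) - 4 * ((d + m : ℕ) : ℝ) ^ (-(1 / 4) : ℝ) := by
    intro m
    induction m with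
    | zero =>
      have : (d : ℝ) ^ (-(5 / 4) : ℝ) ≤ (d : ℝ) ^ (-(1 / 4) : ℝ) :=
        Real.rpow_le_rpow_of_exponent_le hd1 (by norm_num)
      simp only [add_zero, Nat.Ico_succ_singleton, Finset.sum_singleton]
      linarith
    | succ m ih =>
      have hdm : (1 : ℝ) ≤ ((d + m : ℕ) : ℝ) := by exact_mod_cast (by omega : 1 ≤ d + m)
      have ht := rpow_neg_telescope hdm
      rw [Finset.sum_Ico_succ_top (by omega)]
      have hc : ((d + (m + 1) : ℕ) : ℝ) = ((d + m : ℕ) : ℝ) + 1 := by push_cast; ring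
      rw [hc]
      have : d + m + 1 = d + (m + 1) := by ring
      rw [this] at ih
      linarith
  obtain ⟨b, hb⟩ := J.exists_nat_subset_range
  calc _ ≤ ∑ j ∈ Finset.Ico d (d + b + 1), (j : ℝ) ^ (-(5 / 4) : ℝ) := by
        refine Finset.sum_le_sum_of_subset_of_nonneg (fun j hj => ?_) fun j _ _ => by positivity
        obtain ⟨h1, h2⟩ := Finset.mem_filter.1 hj
        have := Finset.mem_range.1 (hb h1)
        exact Finset.mem_Ico.2 ⟨h2, by omega⟩
    _ ≤ _ := hind b
    _ ≤ _ := by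
        have : 0 ≤ ((d + b : ℕ) : ℝ) ^ (-(1 / 4) : ℝ) := by positivity
        linarith

/-- The sum over squared lengths outside the Fermi ball. -/
theorem sum_exterior_le {s : ℝ} (hs : 0 ≤ s) (hs' : s ≤ 3 / 4) {M N : ℕ} (hMN : M < N)
    {R : ℝ} (hR : (N : ℝ) ≤ R) (I : Finset ℕ) :
    ∑ n ∈ I, ((n : ℝ) + 1) ^ s * (if N ≤ n then 4 / ((n : ℝ) - M) ^ 2 else 0) ≤
      20 * (2 * R) ^ s / ((N : ℝ) - M) := by
  obtain ⟨d, rfl⟩ := Nat.exists_eq_add_of_lt hMN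
  set D := d + 1 with hD
  have hND : M + d + 1 = M + D := by omega
  rw [hND] at hR ⊢
  have hD1 : (1 : ℝ) ≤ D := by exact_mod_cast (by omega : 1 ≤ D)
  have hD0 : (0 : ℝ) < D := by linarith
  have hM0 : (0 : ℝ) ≤ M := M.cast_nonneg
  push_cast at hR ⊢
  have hR0 : 0 < R := by linarith
  rw [add_sub_cancel_left]
  -- With `n = M + j` and `j ≥ D`, one has `n + 1 ≤ 2R (j/D)`. Since `s ≤ 3/4`, the power `(j/D)^s`
  -- is at most `(j/D)^(3/4)`, leaving the summable `j^(-5/4)`; the tail supplies the missing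
  -- `D^(-1/4)`.
  have term : ∀ j : ℕ, D ≤ j → (((M + j : ℕ) : ℝ) + 1) ^ s * (4 / (j : ℝ) ^ 2) ≤
      4 * (2 * R) ^ s * (D : ℝ) ^ (-(3 / 4) : ℝ) * (j : ℝ) ^ (-(5 / 4) : ℝ) := by
    intro j hj
    have hj' : (D : ℝ) ≤ j := by exact_mod_cast hj
    have hj0 : (0 : ℝ) < j := by linarith
    have hq : 1 ≤ (j : ℝ) / D := (one_le_div hD0).2 hj'
    have h1 : ((M + j : ℕ) : ℝ) + 1 ≤ 2 * R * (j / D) := by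
      have hjD : (j : ℝ) = D * (j / D) := by field_simp
      push_cast
      nlinarith
    have h2 : (((M + j : ℕ) : ℝ) + 1) ^ s ≤ (2 * R) ^ s * ((j : ℝ) / D) ^ (3 / 4 : ℝ) := by
      calc _ ≤ (2 * R * (j / D)) ^ s := Real.rpow_le_rpow (by positivity) h1 hs
        _ = (2 * R) ^ s * ((j : ℝ) / D) ^ s := Real.mul_rpow (by positivity) (by positivity)
        _ ≤ _ := by gcongr
    have h3 : (j : ℝ) ^ (3 / 4 : ℝ) / (j : ℝ) ^ 2 = (j : ℝ) ^ (-(5 / 4) : ℝ) := by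
      rw [← Real.rpow_natCast, ← Real.rpow_sub hj0]; norm_num
    calc _ ≤ (2 * R) ^ s * ((j : ℝ) / D) ^ (3 / 4 : ℝ) * (4 / (j : ℝ) ^ 2) := by gcongr
      _ = 4 * (2 * R) ^ s * (D : ℝ) ^ (-(3 / 4) : ℝ) * ((j : ℝ) ^ (3 / 4 : ℝ) / (j : ℝ) ^ 2) := by
          rw [Real.div_rpow hj0.le hD0.le, Real.rpow_neg hD0.le]; ring
      _ = _ := by rw [h3]
  have hshift : ∑ n ∈ I, ((n : ℝ) + 1) ^ s * (if M + D ≤ n then 4 / ((n : ℝ) - M) ^ 2 else 0) =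
      ∑ j ∈ (I.image fun n => n - M) with D ≤ j,
        (((M + j : ℕ) : ℝ) + 1) ^ s * (4 / (j : ℝ) ^ 2) := by
    simp_rw [mul_ite, mul_zero]
    rw [← Finset.sum_filter]
    refine Finset.sum_nbij' (fun n => n - M) (fun j => M + j) ?_ ?_ ?_ ?_ ?_
    · intro n hn
      obtain ⟨h1, h2⟩ := Finset.mem_filter.1 hn
      exact Finset.mem_filter.2 ⟨Finset.mem_image_of_mem _ h1, by omega⟩
    · intro j hj
      obtain ⟨h1, h2⟩ := Finset.mem_filter.1 hj
      obtain ⟨n, hn, rfl⟩ := Finset.mem_image.1 h1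
      have : M + (n - M) = n := by omega
      rw [this]
      exact Finset.mem_filter.2 ⟨hn, by omega⟩
    · intro n hn
      have := (Finset.mem_filter.1 hn).2
      omega
    · intro j _
      omega
    · intro n hn
      have h2 := (Finset.mem_filter.1 hn).2
      have h3 : M + (n - M) = n := by omega
      rw [h3, Nat.cast_sub (by omega)]
  rw [hshift]
  calc _ ≤ ∑ j ∈ (I.image fun n => n - M) with D ≤ j,
        4 * (2 * R) ^ s * (D : ℝ) ^ (-(3 / 4) : ℝ) * (j : ℝ) ^ (-(5 / 4) : ℝ) :=
        Finset.sum_le_sum fun j hj => term j (Finset.mem_filter.1 hj).2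
    _ ≤ 4 * (2 * R) ^ s * (D : ℝ) ^ (-(3 / 4) : ℝ) * (5 * (D : ℝ) ^ (-(1 / 4) : ℝ)) := by
        rw [← Finset.mul_sum]
        gcongr
        exact sum_tail_rpow_le (by omega) _
    _ = 20 * (2 * R) ^ s * ((D : ℝ) ^ (-(3 / 4) : ℝ) * (D : ℝ) ^ (-(1 / 4) : ℝ)) := by ring
    _ = _ := by
        have : (D : ℝ) ^ (-(3 / 4) : ℝ) * (D : ℝ) ^ (-(1 / 4) : ℝ) = (D : ℝ)⁻¹ := by
          rw [← Real.rpow_add hD0, ← Real.rpow_neg_one]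
          norm_num
        rw [this, ← div_eq_mul_inv]

/-! ### Lunes, gaps and `κ` in terms of squared lengths. -/

theorem gap_eq (k p : Lattice) : gap k p = ((sqNorm p : ℝ) - sqNorm (p - k)) / 2 := by
  rw [gap, eNorm_sq, eNorm_sq]; ring

theorem mem_lune_iff {kF : ℝ} (hk : 0 ≤ kF) (k p : Lattice) :
    p ∈ lune kF k ↔ (sqNorm (p - k) : ℝ) ≤ kF ^ 2 ∧ kF ^ 2 < sqNorm p := by
  rw [lune, Set.mem_ofPred_eq, eNorm_le_iff hk, lt_eNorm_iff hk]

theorem mem_holeLune_iff {kF : ℝ} (hk : 0 ≤ kF) (k p : Lattice) :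
    p ∈ holeLune kF k ↔ (sqNorm p : ℝ) ≤ kF ^ 2 ∧ kF ^ 2 < sqNorm (k + p) := by
  rw [holeLune, Set.mem_image]
  constructor
  · rintro ⟨q, hq, rfl⟩
    rw [mem_lune_iff hk] at hq
    rwa [add_sub_cancel]
  · intro h
    refine ⟨k + p, ?_, add_sub_cancel_left k p⟩
    rwa [mem_lune_iff hk, add_sub_cancel_left]

theorem m_nonneg (kF : ℝ) (p : Lattice) : 0 ≤ m kF p := inv_nonneg.2 (abs_nonneg _)

/-- The smallest squared length `N` outside the Fermi ball, with the position of `κ` relative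
to it and to the squared lengths `M` inside the ball. -/
theorem exists_outer_shell {kF : ℝ} (hk : 1 ≤ kF) :
    ∃ N : ℕ, kF ^ 2 < N ∧ (N : ℝ) ≤ 4 * kF ^ 2 ∧
      (∀ p : Lattice, kF ^ 2 < sqNorm p → N ≤ sqNorm p) ∧
      kappa kF ≤ N ∧ ∀ p : Lattice, (sqNorm p : ℝ) ≤ kF ^ 2 → (sqNorm p : ℝ) < kappa kF := by
  have hk0 : 0 ≤ kF := by linarith
  classical
  -- This point lies outside the ball, and its squared length is at most `(2 kF) ^ 2` because `kF ≥
  -- 1`.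
  set v : Lattice := ![(⌊kF⌋₊ + 1 : ℕ), 0, 0]
  have hv : sqNorm v = (⌊kF⌋₊ + 1) ^ 2 := by
    simp only [sqNorm, Fin.sum_univ_three, v]
    simp only [Matrix.cons_val_zero, Matrix.cons_val_one, Matrix.cons_val, Int.natAbs_natCast,
      Int.natAbs_zero]
    ring
  have hvk : kF ^ 2 < sqNorm v := by
    rw [hv]
    push_cast
    have := Nat.lt_floor_add_one kF
    gcongr
  have hex : ∃ n : ℕ, ∃ p : Lattice, sqNorm p = n ∧ kF ^ 2 < n := ⟨_, v, rfl, hvk⟩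
  obtain ⟨p₀, hp₀, hN⟩ := Nat.find_spec hex
  set N := Nat.find hex
  have hmin : ∀ p : Lattice, kF ^ 2 < sqNorm p → N ≤ sqNorm p :=
    fun p hp => Nat.find_min' hex ⟨p, rfl, hp⟩
  have hinf : sInf ((fun p => eNorm p ^ 2) '' (fermiBall kF)ᶜ) = N := by
    refine IsLeast.csInf_eq ⟨⟨p₀, ?_, ?_⟩, ?_⟩
    · rw [fermiBall, Set.mem_compl_iff, Set.mem_ofPred_eq, eNorm_le_iff hk0, not_le, hp₀]
      exact hN
    · simp only [eNorm_sq, hp₀]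
    · rintro _ ⟨p, hp, rfl⟩
      rw [fermiBall, Set.mem_compl_iff, Set.mem_ofPred_eq, eNorm_le_iff hk0, not_le] at hp
      simp only [eNorm_sq]
      exact_mod_cast hmin p hp
  have hub : ∀ x ∈ (fun q => eNorm q ^ 2) '' fermiBall kF, x ≤ kF ^ 2 := by
    rintro _ ⟨p, hp, rfl⟩
    rw [fermiBall, Set.mem_ofPred_eq, eNorm_le_iff hk0] at hp
    simpa only [eNorm_sq] using hp
  have hsup : sSup ((fun q => eNorm q ^ 2) '' fermiBall kF) ≤ kF ^ 2 :=
    Real.sSup_le hub (by positivity)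
  refine ⟨N, hN, ?_, hmin, ?_, ?_⟩
  · have h1 : (N : ℝ) ≤ sqNorm v := by exact_mod_cast hmin v hvk
    have h2 := Nat.floor_le hk0
    rw [hv] at h1
    push_cast at h1
    calc (N : ℝ) ≤ _ := h1
      _ ≤ (2 * kF) ^ 2 := by gcongr; linarith
      _ = _ := by ring
  · rw [kappa, hinf]; linarith
  · intro p hp
    have : (sqNorm p : ℝ) ≤ sSup ((fun q => eNorm q ^ 2) '' fermiBall kF) :=
      le_csSup ⟨_, hub⟩ ⟨p, by rwa [fermiBall, Set.mem_ofPred_eq, eNorm_le_iff hk0],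
        by simp only [eNorm_sq]⟩
    rw [kappa, hinf]; linarith

/-! ### The two lattice sums. -/

/-- The sum of `1 / λ` over the lunes containing a fixed point. -/
theorem exists_lune_sum_le {δ : ℝ} (hδ : 0 < δ) :
    ∃ C : ℝ, 0 < C ∧ ∀ kF : ℝ, 1 ≤ kF → ∀ ξ : Lattice,
      Summable (fun k : LatticeStar => chi (lune kF k) ξ / gap k ξ) ∧
        ∑' k : LatticeStar, chi (lune kF k) ξ / gap k ξ ≤ C * kF ^ (1 + δ) := by
  obtain ⟨C, hC0, hC⟩ := exists_card_sphere_le (s := 1 / 2 + δ / 4) (by linarith)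
  -- One `δ / 4` pays for the sphere count and another for the logarithm; squaring `kF` doubles the
  -- total to `1 + δ`.
  set s := 1 / 2 + δ / 4 with hs
  refine ⟨C * (2 * (1 + 4 / δ) * 2 ^ ((1 + δ) / 2)), by positivity, fun kF hk ξ => ?_⟩
  have hk0 : 0 < kF := by linarith
  by_cases hξ : kF ^ 2 < sqNorm ξ
  · set N := ⌊kF ^ 2⌋₊
    have hN : (N : ℝ) ≤ kF ^ 2 := Nat.floor_le (by positivity)
    have hNM : N < sqNorm ξ := by exact_mod_cast hN.trans_lt hξ
    have hlun : ∀ k : Lattice, ξ ∈ lune kF k ↔ sqNorm (ξ - k) ≤ N := by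
      intro k
      rw [mem_lune_iff hk0.le, Nat.le_floor_iff (by positivity), and_iff_left hξ]
    have hf : ∀ k : LatticeStar, chi (lune kF k) ξ / gap k ξ =
        if sqNorm (ξ - k) ≤ N then 2 / ((sqNorm ξ : ℝ) - sqNorm (ξ - k)) else 0 := by
      intro k
      split_ifs with h
      · rw [chi, Set.indicator_of_mem ((hlun k).2 h), Pi.one_apply, gap_eq, one_div_div]
      · rw [chi, Set.indicator_of_notMem (mt (hlun k).1 h), zero_div]
    have hg : ∀ n : ℕ, 0 ≤ if n ≤ N then 2 / ((sqNorm ξ : ℝ) - n) else 0 := by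
      intro n
      split_ifs with h
      · have : (n : ℝ) ≤ sqNorm ξ := by exact_mod_cast h.trans hNM.le
        exact div_nonneg zero_le_two (by linarith)
      · exact le_rfl
    have hmain := sum_radial_le hC (e := fun k : LatticeStar => ξ - k)
      (fun a b hab => Subtype.ext (sub_right_injective hab)) hg
      (sum_interior_le (by positivity) hNM) hC0.le
      (f := fun k : LatticeStar => chi (lune kF k) ξ / gap k ξ)
      (fun k => by rw [hf k]; exact hg _) (fun k => (hf k).le)
    refine ⟨hmain.1, hmain.2.trans ?_⟩
    rw [mul_assoc C]
    refine mul_le_mul_of_nonneg_left ?_ hC0.le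
    have hx1 : (1 : ℝ) ≤ (N : ℝ) + 1 := by linarith [N.cast_nonneg (α := ℝ)]
    have hx2 : (N : ℝ) + 1 ≤ 2 * kF ^ 2 := by nlinarith
    have hlog : 1 + Real.log ((N : ℝ) + 1) ≤ (1 + 4 / δ) * ((N : ℝ) + 1) ^ (δ / 4) := by
      have h1 := Real.log_le_rpow_div (zero_le_one.trans hx1) (ε := δ / 4) (by positivity)
      have h2 : 1 ≤ ((N : ℝ) + 1) ^ (δ / 4) := Real.one_le_rpow hx1 (by positivity)
      calc _ ≤ ((N : ℝ) + 1) ^ (δ / 4) + ((N : ℝ) + 1) ^ (δ / 4) / (δ / 4) := add_le_add h2 h1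
        _ = _ := by field_simp
    calc _ ≤ 2 * ((N : ℝ) + 1) ^ s * ((1 + 4 / δ) * ((N : ℝ) + 1) ^ (δ / 4)) := by gcongr
      _ = 2 * (1 + 4 / δ) * (((N : ℝ) + 1) ^ s * ((N : ℝ) + 1) ^ (δ / 4)) := by ring
      _ = 2 * (1 + 4 / δ) * ((N : ℝ) + 1) ^ ((1 + δ) / 2) := by
          rw [← Real.rpow_add (by linarith), hs]; congr 2; ring
      _ ≤ 2 * (1 + 4 / δ) * (2 * kF ^ 2) ^ ((1 + δ) / 2) := by gcongr
      _ = _ := by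
          rw [Real.mul_rpow zero_le_two (by positivity), ← Real.rpow_natCast kF 2,
            ← Real.rpow_mul hk0.le, mul_assoc _ (_ ^ _)]
          congr 3
          push_cast
          ring
  · have h0 : HasSum (fun k : LatticeStar => chi (lune kF k) ξ / gap k ξ) 0 := by
      convert! hasSum_zero with k
      rw [chi, Set.indicator_of_notMem (fun h => hξ ((mem_lune_iff hk0.le _ _).1 h).2), zero_div]
    exact ⟨h0.summable, h0.tsum_eq.le.trans (by positivity)⟩

/-- The sum of `1 / λ ^ 2` over the hole lunes containing a fixed point, for small `δ`. -/
theorem exists_holeLune_sum_le {δ : ℝ} (hδ : 0 < δ) (hδ' : δ ≤ 1 / 2) :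
    ∃ C : ℝ, 0 < C ∧ ∀ kF : ℝ, 1 ≤ kF → ∀ ξ : Lattice,
      Summable (fun k : LatticeStar => chi (holeLune kF k) ξ / gap k (k + ξ) ^ 2) ∧
        ∑' k : LatticeStar, chi (holeLune kF k) ξ / gap k (k + ξ) ^ 2
          ≤ C * kF ^ (1 + δ) * m kF ξ := by
  obtain ⟨C, hC0, hC⟩ := exists_card_sphere_le (s := 1 / 2 + δ / 2) (by linarith)
  -- No logarithm arises here, so `2 s = 1 + δ`; the restriction `δ ≤ 1 / 2` is exactly `s ≤ 3 / 4`.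
  set s := 1 / 2 + δ / 2 with hs
  refine ⟨C * (20 * 8 ^ s), by positivity, fun kF hk ξ => ?_⟩
  have hk0 : 0 < kF := by linarith
  by_cases hξ : (sqNorm ξ : ℝ) ≤ kF ^ 2
  · obtain ⟨N, hN, hN4, hmin, hκN, hκ⟩ := exists_outer_shell hk
    have hMN : sqNorm ξ < N := by exact_mod_cast hξ.trans_lt hN
    have hlun : ∀ k : Lattice, ξ ∈ holeLune kF k ↔ N ≤ sqNorm (k + ξ) := by
      intro k
      rw [mem_holeLune_iff hk0.le, and_iff_right hξ]
      exact ⟨hmin _, fun h => hN.trans_le (by exact_mod_cast h)⟩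
    have hf : ∀ k : LatticeStar, chi (holeLune kF k) ξ / gap k (k + ξ) ^ 2 =
        if N ≤ sqNorm (k + ξ) then 4 / ((sqNorm (k + ξ) : ℝ) - sqNorm ξ) ^ 2 else 0 := by
      intro k
      split_ifs with h
      · rw [chi, Set.indicator_of_mem ((hlun k).2 h), Pi.one_apply, gap_eq, add_sub_cancel_left,
          div_pow, one_div_div]
        norm_num
      · rw [chi, Set.indicator_of_notMem (mt (hlun k).1 h), zero_div]
    have hg : ∀ n : ℕ, 0 ≤ if N ≤ n then 4 / ((n : ℝ) - sqNorm ξ) ^ 2 else 0 := by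
      intro n
      split_ifs <;> positivity
    have hmain := sum_radial_le hC (e := fun k : LatticeStar => (k : Lattice) + ξ)
      (fun a b hab => Subtype.ext (add_left_injective ξ hab)) hg
      (sum_exterior_le (by positivity) (by linarith) hMN hN4) hC0.le
      (f := fun k : LatticeStar => chi (holeLune kF k) ξ / gap k (k + ξ) ^ 2)
      (fun k => by rw [hf k]; exact hg _) (fun k => (hf k).le)
    refine ⟨hmain.1, hmain.2.trans ?_⟩
    rw [mul_assoc C, mul_assoc C]
    refine mul_le_mul_of_nonneg_left ?_ hC0.le
    have hm : ((N : ℝ) - sqNorm ξ)⁻¹ ≤ m kF ξ := by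
      have := hκ ξ hξ
      rw [m, eNorm_sq, abs_of_neg (by linarith), neg_sub]
      exact inv_anti₀ (by linarith) (by linarith)
    have hpow : (2 * (4 * kF ^ 2)) ^ s = 8 ^ s * kF ^ (1 + δ) := by
      have : 2 * (4 * kF ^ 2) = 8 * kF ^ 2 := by ring
      rw [this, Real.mul_rpow (by norm_num) (by positivity), ← Real.rpow_natCast kF 2,
        ← Real.rpow_mul hk0.le, hs]
      congr 2
      push_cast
      ring
    rw [hpow, div_eq_mul_inv, ← mul_assoc]
    gcongr
  · have h0 : HasSum (fun k : LatticeStar => chi (holeLune kF k) ξ / gap k (k + ξ) ^ 2) 0 := by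
      convert! hasSum_zero with k
      rw [chi, Set.indicator_of_notMem (fun h => hξ ((mem_holeLune_iff hk0.le _ _).1 h).1),
        zero_div]
    have := m_nonneg kF ξ
    exact ⟨h0.summable, h0.tsum_eq.le.trans (by positivity)⟩

end FermiGas

theorem lemma2p9 :
    ∀ δ : ℝ, 0 < δ → ∃ C : ℝ, 0 < C ∧ ∀ kF : ℝ, 1 ≤ kF → ∀ ξ : FermiGas.Lattice,
      (Summable (fun k : FermiGas.LatticeStar =>
          FermiGas.chi (FermiGas.lune kF k) ξ / FermiGas.gap k ξ) ∧
        ∑' k : FermiGas.LatticeStar,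
          FermiGas.chi (FermiGas.lune kF k) ξ / FermiGas.gap k ξ ≤ C * kF ^ (1 + δ)) ∧
      (Summable (fun k : FermiGas.LatticeStar =>
          FermiGas.chi (FermiGas.holeLune kF k) ξ / FermiGas.gap k (k + ξ) ^ 2) ∧
        ∑' k : FermiGas.LatticeStar,
          FermiGas.chi (FermiGas.holeLune kF k) ξ / FermiGas.gap k (k + ξ) ^ 2
            ≤ C * kF ^ (1 + δ) * FermiGas.m kF ξ) := by
  intro δ hδ
  obtain ⟨C₁, hC₁, h₁⟩ := FermiGas.exists_lune_sum_le hδ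
  -- Large `δ` reduces to `1 / 2`, since `kF ≥ 1` makes the bound increasing in `δ`.
  obtain ⟨C₂, hC₂, h₂⟩ := FermiGas.exists_holeLune_sum_le (δ := min δ (1 / 2))
    (lt_min hδ (by norm_num)) (min_le_right _ _)
  refine ⟨max C₁ C₂, lt_max_of_lt_left hC₁, fun kF hk ξ =>
    ⟨⟨(h₁ kF hk ξ).1, (h₁ kF hk ξ).2.trans ?_⟩, (h₂ kF hk ξ).1, (h₂ kF hk ξ).2.trans ?_⟩⟩
  · gcongr
    exact le_max_left _ _
  · have := FermiGas.m_nonneg kF ξ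
    gcongr
    · exact le_max_right _ _
    · exact min_le_left _ _
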